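/- **Setting.** Let $L\subset\mathbb R^n$ be a lattice (a discrete subgroup spanning $\mathbb R^n$). An *inflation* of $L$ is a $Q\in\operatorname{End}_{\mathbb Z}(L)$ with $\det Q\neq 0$ and $\bigcap_{k\ge 0}Q^kL=\{0\}$. An $m\times m$ *matrix function system* (MFS) on $L$ is a matrix $\Phi=(\Phi_{ij})$ of finite sets $\Phi_{ij}$ of maps $L\to L$; its *substitution matrix* is $S(\Phi)=(\operatorname{card}\Phi_{ij})_{ij}$. $\Phi$ is *primitive* if some positive power of $S(\Phi)$ has only positive entries; the *PF-eigenvalue* of $S(\Phi)$ is then its Perron–Frobenius eigenvalue, i.e. the unique eigenvalue possessing a strictly positive right eigenvector, and such an eigenvector is called a right PF-eigenvector. The composition of MFSs is $(\Psi\circ\Phi)_{ij}=\bigcup_k\{g\circ f: g\in\Psi_{ik},\,f\in\Phi_{kj}\}$, and $\Phi^M$ denotes the $M$-fold composition. A *substitution system on $L$ with inflation $Q$* is a pair $(\tilde U,\Phi)$, where $\tilde U=(U_1,\dots,U_m)$ is a tuple of pairwise disjoint subsets of $L$, $Q$ is an inflation of $L$, and $\Phi$ is an $m\times m$ MFS all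 of whose maps are of the form $x\mapsto Qx+a$ with $a\in L$, such that for every $i$ $$U_i=\bigcup_{j=1}^m\bigcup_{f\in\Phi_{ij}}f(U_j),$$ this union being disjoint. It is primitive if $\Phi$ is. Two substitution systems $(\tilde U',\Psi)$ and $(\tilde U,\Phi)$ are *equivalent* if $\tilde U'=\tilde U$, they have the same inflation, and $S(\Psi),S(\Phi)$ have the same PF-eigenvalue and, up to a scalar factor, the same right PF-eigenvector. $\Psi$ *admits a coincidence* if $\bigcap_{j=1}^m\Psi_{ij}\neq\emptyset$ for some $i$. $(\tilde U,\Phi)$ *admits a modular coincidence* if there are $M>0$, $a\in L$ and a row index $i$ such that every entry of $\Phi^M$ containing a map $f$ with $f(0)\equiv a \bmod Q^ML$ lies in the $i$-th row, that is, whenever $f\in(\Phi^M)_{i'j}$ and $f(0)\equiv a\bmod Q^ML$, then $i'=i$. Let $\overline L=\varprojlim_k L/Q^kL$ be the $Q$-adic completion of $L$ with its profinite topology, in which $L$ is embedded canonically, and let $\tilde L=\{(t,t):t\in L\}\subset\mathbb R^n\times\overline L$. This is a cut and project scheme: $\tilde L$ is a discrete subgroup with compact quotient, it projects injectively to $\mathbb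 R^n$, and its projection to $\overline L$ is dense. A *model set* for this scheme is a subset of $\mathbb R^n$ which is a translate of $\Lambda(V)=\{t\in L: t\in V\}$ for some relatively compact $V\subset\overline L$ with non-empty interior. **Theorem.** Let $(\tilde U,\Phi)$ be a primitive substitution system with inflation $Q$ on the lattice $L\subset\mathbb R^n$. Suppose that the PF-eigenvalue of $S(\Phi)$ is equal to $|\det Q|$ and that $L=\bigcup_{i=1}^mU_i$. Then the following are equivalent. (i) There are $M\ge 1$ and a primitive MFS $\Psi$ admitting a coincidence such that $(\tilde U,\Psi)$ is a substitution system equivalent to $(\tilde U,\Phi^M)$ (both with inflation $Q^M$). (ii) All the sets $U_1,\dots,U_m$ are model sets for the cut and project scheme $(\mathbb R^n\times\overline L,\tilde L)$. (iii) For at least one $i$, $U_i$ contains a coset $a+Q^ML$ with $a\in L$, $M\ge 0$. (iv) $(\tilde U,\Phi)$ admits a modular coincidence. -/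

import Mathlib

/-! ### Matrix function systems -/

/-- An `m × m` matrix function system (MFS) on `X`: a matrix of sets of self-maps of `X`. -/
def MFS (m : ℕ) (X : Type*) := Fin m → Fin m → Set (X → X)

namespace MFS

variable {m : ℕ} {X : Type*}

/-- The substitution matrix, with entries `card (Φ i j)`. -/
noncomputable def substMatrix (Φ : MFS m X) : Matrix (Fin m) (Fin m) ℝ :=
  Matrix.of fun i j => ((Φ i j).ncard : ℝ)

/-- An MFS is primitive if its substitution matrix is: some positive power of it has only positive
entries. -/
def IsPrimitive (Φ : MFS m X) : Prop := Φ.substMatrix.IsPrimitive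

/-- Composition: `(Ψ ∘ Φ) i j = ⋃ k, {g ∘ f | g ∈ Ψ i k, f ∈ Φ k j}`. -/
def comp (Ψ Φ : MFS m X) : MFS m X := fun i j =>
  {h | ∃ k, ∃ g ∈ Ψ i k, ∃ f ∈ Φ k j, h = g ∘ f}

/-- The identity MFS: `{id}` on the diagonal, `∅` elsewhere. -/
def one : MFS m X := fun i j => {h | i = j ∧ h = id}

/-- Iterates of an MFS. -/
def iter (Φ : MFS m X) : ℕ → MFS m X
  | 0 => one
  | k + 1 => (Φ.iter k).comp Φ

/-- The substitution on `m`-tuples of sets determined by `Φ`. -/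
def apply (Φ : MFS m X) (U : Fin m → Set X) : Fin m → Set X := fun i =>
  ⋃ j, ⋃ f ∈ Φ i j, f '' U j

/-- Coincidence: one and the same map appears in every set of some row. -/
def AdmitsCoincidence (Φ : MFS m X) : Prop := ∃ i, (⋂ j, Φ i j).Nonempty

end MFS

/-! ### Perron-Frobenius eigenvalue and eigenvector -/

/-- `r` is the Perron-Frobenius eigenvalue and `v` a right Perron-Frobenius eigenvector of the
non-negative matrix `A`: `v` is strictly positive and `A v = r v`. That `r` is the spectral radius
(hence determined by `A`) is `IsPFPair.norm_eigenvalue_le` below. -/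
structure IsPFPair {m : ℕ} (A : Matrix (Fin m) (Fin m) ℝ) (r : ℝ) (v : Fin m → ℝ) : Prop where
  pos : ∀ i, 0 < v i
  eigen : A.mulVec v = r • v

/-- `r` is the Perron-Frobenius eigenvalue of `A`. -/
def IsPFEigenvalue {m : ℕ} (A : Matrix (Fin m) (Fin m) ℝ) (r : ℝ) : Prop :=
  ∃ v, IsPFPair A r v

theorem IsPFPair.norm_eigenvalue_le {m : ℕ} {A : Matrix (Fin m) (Fin m) ℝ} {r : ℝ}
    {v : Fin m → ℝ} (hA : ∀ i j, 0 ≤ A i j) (h : IsPFPair A r v) {μ : ℂ} {y : Fin m → ℂ}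
    (hy : y ≠ 0) (hμ : (A.map Complex.ofReal).mulVec y = μ • y) : ‖μ‖ ≤ r := by
  obtain ⟨i₀, hi₀⟩ := Function.ne_iff.mp hy
  obtain ⟨i, -, hi⟩ := Finset.exists_max_image Finset.univ (fun i => ‖y i‖ / v i) ⟨i₀, by simp⟩
  have hc : 0 < ‖y i‖ / v i :=
    lt_of_lt_of_le (div_pos (norm_pos_iff.mpr hi₀) (h.pos i₀)) (hi i₀ (by simp))
  have hb : ∀ j, ‖y j‖ ≤ ‖y i‖ / v i * v j := fun j =>
    (div_le_iff₀ (h.pos j)).mp (hi j (by simp))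
  have h1 : μ * y i = ∑ j, (A i j : ℂ) * y j := by
    have := congrFun hμ i
    simpa [Matrix.mulVec, dotProduct] using this.symm
  have h2 : ∑ j, A i j * v j = r * v i := by
    have := congrFun h.eigen i
    simpa [Matrix.mulVec, dotProduct] using this
  have h3 : ‖μ‖ * ‖y i‖ ≤ r * ‖y i‖ := by
    calc ‖μ‖ * ‖y i‖ = ‖∑ j, (A i j : ℂ) * y j‖ := by rw [← norm_mul, h1]
      _ ≤ ∑ j, A i j * (‖y i‖ / v i * v j) := by
          refine (norm_sum_le _ _).trans (Finset.sum_le_sum fun j _ => ?_)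
          rw [norm_mul, Complex.norm_real, Real.norm_of_nonneg (hA i j)]
          exact mul_le_mul_of_nonneg_left (hb j) (hA i j)
      _ = ‖y i‖ / v i * ∑ j, A i j * v j := by
          rw [Finset.mul_sum]; exact Finset.sum_congr rfl fun j _ => by ring
      _ = r * ‖y i‖ := by rw [h2]; field_simp [(h.pos i).ne']
  have hyi : 0 < ‖y i‖ := by
    by_contra hn
    have : ‖y i‖ = 0 := le_antisymm (not_lt.mp hn) (norm_nonneg _)
    simp [this] at hc
  exact le_of_mul_le_mul_right h3 hyi

/-! ### Inflations and substitution systems on a lattice -/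

section Substitution

variable {A : Type*} [AddCommGroup A]

/-- An inflation of the lattice `A`: an endomorphism `Q` with `det Q ≠ 0` and
`⋂ k, Q ^ k A = {0}`. -/
structure IsInflation (Q : Module.End ℤ A) : Prop where
  det_ne_zero : LinearMap.det Q ≠ 0
  iInf_range : ⨅ k : ℕ, LinearMap.range (Q ^ k) = ⊥

variable {m : ℕ}

/-- `(U, Φ)` is an affine lattice substitution system with inflation `Q`: the `U i` are disjoint,
`Φ` is a finite MFS all of whose maps are `x ↦ Q x + a`, `Φ U = U`, and the unions in `Φ U` are
disjoint. -/
structure IsSubstitutionSystem (Q : Module.End ℤ A) (U : Fin m → Set A) (Φ : MFS m A) : Prop where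
  inflation : IsInflation Q
  disjoint : Pairwise fun i j => Disjoint (U i) (U j)
  finite : ∀ i j, (Φ i j).Finite
  affine : ∀ i j, ∀ f ∈ Φ i j, ∃ a : A, ∀ x, f x = Q x + a
  fixed : Φ.apply U = U
  disjoint_images : ∀ i j j', ∀ f ∈ Φ i j, ∀ f' ∈ Φ i j', (j, f) ≠ (j', f') →
    Disjoint (f '' U j) (f' '' U j')

/-- Equivalence of the substitution systems `(U', Ψ)` (inflation `Q'`) and `(U, Φ)`
(inflation `Q`): same tuple of sets, same inflation, and the substitution matrices have the same
PF-eigenvalue and, up to a factor, the same right PF-eigenvector. -/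
def EquivalentSystems (Q' : Module.End ℤ A) (U' : Fin m → Set A) (Ψ : MFS m A)
    (Q : Module.End ℤ A) (U : Fin m → Set A) (Φ : MFS m A) : Prop :=
  IsSubstitutionSystem Q' U' Ψ ∧ IsSubstitutionSystem Q U Φ ∧ U' = U ∧ Q' = Q ∧
    ∃ r v, IsPFPair Ψ.substMatrix r v ∧ IsPFPair Φ.substMatrix r v

/-- The congruence class `Φ[a]` modulo `Q A`, its members counted with their positions in the
matrix: all triples `(i, j, f)` with `f ∈ Φ i j` and translational part `f 0 ≡ a` mod `Q A`. -/
def MFS.congrClass (Q : Module.End ℤ A) (Φ : MFS m A) (a : A) :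
    Set (Fin m × Fin m × (A → A)) :=
  {p | p.2.2 ∈ Φ p.1 p.2.1 ∧ p.2.2 0 - a ∈ LinearMap.range Q}

/-- Modular coincidence: for some `M > 0` and `a`, the class `Φ^M[a]` modulo `Q ^ M A` lies
entirely in one row of `Φ^M`. -/
def AdmitsModularCoincidence (Q : Module.End ℤ A) (Φ : MFS m A) : Prop :=
  ∃ M : ℕ, 0 < M ∧ ∃ a : A, ∃ i : Fin m, ∀ p ∈ (Φ.iter M).congrClass (Q ^ M) a, p.1 = i

end Substitution

/-! ### The `Q`-adic completion -/

section Completion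

variable {A : Type*} [AddCommGroup A]

/-- The quotient `A / Q ^ k A`, with the discrete topology. -/
def QLevel (Q : Module.End ℤ A) (k : ℕ) : Type _ := A ⧸ LinearMap.range (Q ^ k)

instance (Q : Module.End ℤ A) (k : ℕ) : AddCommGroup (QLevel Q k) :=
  inferInstanceAs (AddCommGroup (A ⧸ LinearMap.range (Q ^ k)))

instance (Q : Module.End ℤ A) (k : ℕ) : TopologicalSpace (QLevel Q k) := ⊥

instance (Q : Module.End ℤ A) (k : ℕ) : DiscreteTopology (QLevel Q k) := ⟨rfl⟩

/-- Reduction `A → A / Q ^ k A`. -/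
def QLevel.mk (Q : Module.End ℤ A) (k : ℕ) : A →+ QLevel Q k :=
  (LinearMap.range (Q ^ k)).mkQ.toAddMonoidHom

theorem range_pow_succ_le (Q : Module.End ℤ A) (k : ℕ) :
    LinearMap.range (Q ^ (k + 1)) ≤ LinearMap.range (Q ^ k) := by
  rintro _ ⟨x, rfl⟩
  exact ⟨Q x, by rw [pow_succ]; rfl⟩

/-- The transition map `A / Q ^ (k + 1) A → A / Q ^ k A`. -/
def QLevel.transition (Q : Module.End ℤ A) (k : ℕ) : QLevel Q (k + 1) →+ QLevel Q k :=
  (Submodule.factor (range_pow_succ_le Q k)).toAddMonoidHom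

/-- The `Q`-adic completion `lim A / Q ^ k A`, as a topological subgroup of the product of the
discrete groups `A / Q ^ k A`. -/
def QCompletion (Q : Module.End ℤ A) : AddSubgroup (∀ k, QLevel Q k) where
  carrier := {x | ∀ k, QLevel.transition Q k (x (k + 1)) = x k}
  add_mem' := fun hx hy k => by simp [hx k, hy k]
  zero_mem' := fun k => by simp
  neg_mem' := fun hx k => by simp [hx k]

/-- The canonical map of `A` to its completion. -/
def QCompletion.of (Q : Module.End ℤ A) : A →+ QCompletion Q where
  toFun a := ⟨fun k => QLevel.mk Q k a, fun _ => rfl⟩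
  map_zero' := rfl
  map_add' _ _ := rfl

theorem QCompletion.ext_level {Q : Module.End ℤ A} {x y : QCompletion Q} {N : ℕ}
    (h : x.1 N = y.1 N) : ∀ k ≤ N, x.1 k = y.1 k := by
  induction N with
  | zero => intro k hk; obtain rfl : k = 0 := by omega
            exact h
  | succ N ih =>
    intro k hk
    rcases Nat.lt_or_ge k (N + 1) with hlt | hge
    · exact ih (by rw [← x.2 N, ← y.2 N, h]) k (by omega)
    · obtain rfl : k = N + 1 := by omega
      exact h

theorem QCompletion.denseRange_of (Q : Module.End ℤ A) : DenseRange (QCompletion.of Q) := by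
  intro x
  rw [mem_closure_iff]
  intro O hO hx
  obtain ⟨O', hO', rfl⟩ := isOpen_induced_iff.mp hO
  obtain ⟨I, u, hu, hIu⟩ := isOpen_pi_iff.mp hO' x.1 hx
  obtain ⟨a, ha⟩ := Submodule.mkQ_surjective _ (x.1 (I.sup id))
  have ha' : (QCompletion.of Q a).1 (I.sup id) = x.1 (I.sup id) := ha
  refine ⟨QCompletion.of Q a, hIu ?_, a, rfl⟩
  intro k hk
  rw [QCompletion.ext_level ha' k (Finset.le_sup (f := id) hk)]
  exact (hu k hk).2

theorem IsInflation.compactSpace [Module.Free ℤ A] [Module.Finite ℤ A] {Q : Module.End ℤ A}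
    (hQ : IsInflation Q) : CompactSpace (QCompletion Q) := by
  have hfin : ∀ k, Finite (QLevel Q k) := fun k => by
    have hinj : Function.Injective (Q ^ k) := by
      have hd : LinearMap.det (Q ^ k) ≠ 0 := by
        rw [map_pow]; exact pow_ne_zero _ hQ.det_ne_zero
      rw [← LinearMap.ker_eq_bot]
      by_contra hne
      exact hd (LinearMap.det_eq_zero_iff_ker_ne_bot.mpr hne)
    exact (Submodule.finiteQuotient_iff _).mpr (LinearMap.finrank_range_of_inj hinj)
  have hclosed : IsClosed (QCompletion Q : Set (∀ k, QLevel Q k)) := by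
    have : (QCompletion Q : Set (∀ k, QLevel Q k)) =
        ⋂ k, {x | QLevel.transition Q k (x (k + 1)) = x k} := by
      ext x; simp [QCompletion]
    rw [this]
    refine isClosed_iInter fun k => isClosed_eq ?_ (continuous_apply k)
    exact continuous_of_discreteTopology.comp (continuous_apply (k + 1))
  exact isCompact_iff_compactSpace.mp hclosed.isCompact

end Completion

/-! ### Cut and project schemes and model sets -/

/-- A cut and project scheme with physical space `E` (a Euclidean space) and internal space the
locally compact Abelian group `G`: a lattice in `E × G`, i.e. a discrete subgroup with compact
quotient, which projects injectively to `E` and densely to `G`. -/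
structure CutProjectScheme (E G : Type*) [NormedAddCommGroup E]
    [AddCommGroup G] [TopologicalSpace G] [IsTopologicalAddGroup G] [T2Space G] where
  locallyCompact : LocallyCompactSpace G
  lattice : AddSubgroup (E × G)
  discrete : DiscreteTopology lattice
  cocompact : CompactSpace ((E × G) ⧸ lattice)
  injOn_fst : Set.InjOn Prod.fst (lattice : Set (E × G))
  dense_snd : Dense (Prod.snd '' (lattice : Set (E × G)))

namespace CutProjectScheme

variable {E G : Type*} [NormedAddCommGroup E]
  [AddCommGroup G] [TopologicalSpace G] [IsTopologicalAddGroup G] [T2Space G]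

/-- `Λ(V)`, the projection to `E` of the lattice points over the window `V`. -/
def cut (S : CutProjectScheme E G) (V : Set G) : Set E :=
  {x | ∃ p ∈ S.lattice, p.1 = x ∧ p.2 ∈ V}

/-- `Y` is a model set for `S`: up to a translation of `E` it is `Λ(V)` for some relatively compact
`V` with non-empty interior. -/
def IsModelSet (S : CutProjectScheme E G) (Y : Set E) : Prop :=
  ∃ V : Set G, (interior V).Nonempty ∧ IsCompact (closure V) ∧
    ∃ t : E, Y = (fun x => t + x) '' S.cut V

end CutProjectScheme

section QAdicScheme

variable {n : ℕ} (L : Submodule ℤ (EuclideanSpace ℝ (Fin n)))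

/-- The diagonal lattice `{(t, t) | t ∈ L}` in `ℝⁿ × L̄`. -/
def diagonalLattice (Q : Module.End ℤ L) :
    AddSubgroup (EuclideanSpace ℝ (Fin n) × QCompletion Q) :=
  (L.subtype.toAddMonoidHom.prod (QCompletion.of Q)).range

/-- The cut and project scheme `ℝⁿ ← ℝⁿ × L̄ → L̄` with lattice `{(t, t) | t ∈ L}`, where `L̄` is the
`Q`-adic completion of the lattice `L`. -/
def qAdicScheme [DiscreteTopology L] [IsZLattice ℝ L] {Q : Module.End ℤ L} (hQ : IsInflation Q) :
    CutProjectScheme (EuclideanSpace ℝ (Fin n)) (QCompletion Q) where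
  locallyCompact := by
    have := hQ.compactSpace
    infer_instance
  lattice := diagonalLattice L Q
  discrete := by
    let φ : diagonalLattice L Q → L := fun p => ⟨p.1.1, by
      obtain ⟨t, ht⟩ := p.2
      rw [← ht]; exact t.2⟩
    refine DiscreteTopology.of_continuous_injective (f := φ) ?_ ?_
    · exact (continuous_fst.comp continuous_subtype_val).subtype_mk _
    · rintro ⟨_, s, rfl⟩ ⟨_, t, rfl⟩ h
      have : s = t := Subtype.ext (congrArg Subtype.val h)
      subst this; rfl
  cocompact := by
    have := hQ.compactSpace
    let b := (Module.Free.chooseBasis ℤ L).ofZLatticeBasis ℝ L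
    have hb : Submodule.span ℤ (Set.range b) = L := (Module.Free.chooseBasis ℤ L).ofZLatticeBasis_span ℝ
    have hK : IsCompact (closure (ZSpan.fundamentalDomain b)) :=
      (ZSpan.fundamentalDomain_isBounded b).isCompact_closure
    have hKc := (hK.prod (isCompact_univ (X := QCompletion Q))).image
      (QuotientAddGroup.continuous_mk (N := diagonalLattice L Q))
    refine ⟨?_⟩
    convert hKc
    symm
    rw [Set.eq_univ_iff_forall]
    intro y
    obtain ⟨⟨x, z⟩, rfl⟩ := QuotientAddGroup.mk_surjective y
    have hmem : ((ZSpan.floor b x : Submodule.span ℤ (Set.range b)) :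
        EuclideanSpace ℝ (Fin n)) ∈ L := hb.le (ZSpan.floor b x).2
    refine ⟨(ZSpan.fract b x, z - QCompletion.of Q ⟨_, hmem⟩),
      ⟨subset_closure (ZSpan.fract_mem_fundamentalDomain b x), trivial⟩, ?_⟩
    rw [QuotientAddGroup.eq]
    refine ⟨⟨_, hmem⟩, ?_⟩
    ext1
    · simp [ZSpan.fract_apply]
    · simp
  injOn_fst := by
    rintro _ ⟨s, rfl⟩ _ ⟨t, rfl⟩ h
    have : s = t := Subtype.ext h
    subst this; rfl
  dense_snd := by
    refine (QCompletion.denseRange_of Q).mono ?_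
    rintro _ ⟨t, rfl⟩
    exact ⟨_, ⟨t, rfl⟩, rfl⟩

end QAdicScheme

/-! Write `q = |det Q|`. Every equivalence passes through (iii). A coincidence in row `i` puts one
map `x ↦ a + Q x` in every column; since the `U j` cover `L`, its whole range lies in `U i`. A
modular coincidence says the same in terms of `Φ ^ M`: every point of `a + Q ^ M L` is the image of
a point under a map whose translational part is congruent to `a`, so the row of that map decides
which `U i` contains the point. In the completion, cosets of `Q ^ k L` are the traces of basic open
sets, and primitivity carries a coset inside one `U i` into all the others; this gives (ii).

The substantial step is (iii) → (i). After passing to a power, `U i` contains `a + Q L` and `S(Φ)`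
is positive. Replacing the maps of row `i` congruent to `a` by `x ↦ a + Q x` in every column gives a
system `Ψ` with a coincidence and the same `U` (`mergeClass`). It remains to find a common
PF-eigenvector, and the densities `d j` of the `U j` serve. An affine map divides density by `q`, so
`S d = q d` for every substitution system on `U`, provided densities are additive, that is, provided
the boundaries of the `U j` are null (`mulVec_density`).

Nullity comes from Perron–Frobenius (`boundary_eq_zero`): the boundary measures satisfy `q b ≤ S b`,
and in row `i` one term can be dropped, because a map with range `a + Q L` inside `U i` contributes
no boundary. As `q` is the PF-eigenvalue, this forces `b = 0`. -/

/-! ### Counting cosets -/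

section Density

open Filter Topology

variable {A : Type*} [AddCommGroup A]

/-- The cosets of `Q ^ k A` which meet `X`. -/
def levelImage (Q : Module.End ℤ A) (k : ℕ) (X : Set A) : Set (A ⧸ LinearMap.range (Q ^ k)) :=
  (LinearMap.range (Q ^ k)).mkQ '' X

/-- The number of cosets of `Q ^ k A` which meet both `X` and `Y`. -/
noncomputable def cosetCount (Q : Module.End ℤ A) (X Y : Set A) (k : ℕ) : ℕ :=
  (levelImage Q k X ∩ levelImage Q k Y).ncard

/-- The limiting proportion of the cosets of `Q ^ k A` which meet both `X` and `Y`, that is, the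
Haar measure of the intersection of the closures of `X` and `Y` in the `Q`-adic completion. -/
noncomputable def jointDensity (Q : Module.End ℤ A) (X Y : Set A) : ℝ :=
  ⨅ k : ℕ, (cosetCount Q X Y k : ℝ) / (((LinearMap.det Q).natAbs : ℕ) : ℝ) ^ k

theorem mkQ_eq_mkQ_iff {Q : Module.End ℤ A} {k : ℕ} {x y : A} :
    (LinearMap.range (Q ^ k)).mkQ x = (LinearMap.range (Q ^ k)).mkQ y ↔
      ∃ z, x = y + (Q ^ k) z := by
  rw [← sub_eq_zero, ← map_sub, Submodule.mkQ_apply, Submodule.Quotient.mk_eq_zero,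
    LinearMap.mem_range]
  exact exists_congr fun z => by rw [eq_comm, sub_eq_iff_eq_add']

theorem IsInflation.injective [Module.Free ℤ A] [Module.Finite ℤ A] {Q : Module.End ℤ A}
    (hQ : IsInflation Q) : Function.Injective Q := by
  rw [← LinearMap.ker_eq_bot]
  by_contra hne
  exact hQ.det_ne_zero (LinearMap.det_eq_zero_iff_ker_ne_bot.mpr hne)

theorem pow_injective_of_injective {Q : Module.End ℤ A} (hQ : Function.Injective Q) (k : ℕ) :
    Function.Injective (Q ^ k) := by
  rw [Module.End.coe_pow]
  exact hQ.iterate k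

theorem card_quotient_range_pow [Module.Free ℤ A] [Module.Finite ℤ A] {Q : Module.End ℤ A}
    (hQ : Function.Injective Q) (k : ℕ) :
    Nat.card (A ⧸ LinearMap.range (Q ^ k)) = (LinearMap.det Q).natAbs ^ k := by
  have hinj := pow_injective_of_injective hQ k
  rw [← Submodule.natAbs_det_equiv _ (LinearEquiv.ofInjective (Q ^ k) hinj), ← Int.natAbs_pow,
    ← map_pow]
  congr 2

theorem finite_quotient_range_pow [Module.Free ℤ A] [Module.Finite ℤ A] {Q : Module.End ℤ A}
    (hQ : Function.Injective Q) (k : ℕ) : Finite (A ⧸ LinearMap.range (Q ^ k)) :=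
  (Submodule.finiteQuotient_iff _).mpr
    (LinearMap.finrank_range_of_inj (pow_injective_of_injective hQ k))

theorem natAbs_det_pos [Module.Free ℤ A] [Module.Finite ℤ A] {Q : Module.End ℤ A}
    (hQ : Function.Injective Q) : 0 < (((LinearMap.det Q).natAbs : ℕ) : ℝ) := by
  have := finite_quotient_range_pow hQ 1
  have h := card_quotient_range_pow hQ 1
  rw [pow_one (LinearMap.det Q).natAbs] at h
  rw [← h]
  exact_mod_cast Nat.card_pos

section FreeFinite

variable [Module.Free ℤ A] [Module.Finite ℤ A] {Q : Module.End ℤ A}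

/-- Each coset of `Q ^ k A` splits into `|det Q|` cosets of `Q ^ (k + 1) A`. Hence the proportions
in `jointDensity` decrease and their infimum is a limit. -/
theorem cosetCount_succ_le (hQ : Function.Injective Q) (X Y : Set A) (k : ℕ) :
    cosetCount Q X Y (k + 1) ≤ cosetCount Q X Y k * (LinearMap.det Q).natAbs := by
  have hf := finite_quotient_range_pow hQ
  let s := levelImage Q k X ∩ levelImage Q k Y
  -- A coset of `Q ^ (k + 1) A` is encoded by the coset of `Q ^ k A` around it and one further digit
  -- modulo `Q A`.
  let F : (A ⧸ LinearMap.range (Q ^ k)) × (A ⧸ LinearMap.range (Q ^ 1)) →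
      A ⧸ LinearMap.range (Q ^ (k + 1)) :=
    fun p => (LinearMap.range (Q ^ (k + 1))).mkQ (p.1.out + (Q ^ k) p.2.out)
  have key : ∀ y, ∃ d, (LinearMap.range (Q ^ (k + 1))).mkQ y =
      F ((LinearMap.range (Q ^ k)).mkQ y, d) := by
    intro y
    obtain ⟨e, he⟩ := mkQ_eq_mkQ_iff.mp
      (show (LinearMap.range (Q ^ k)).mkQ y = (LinearMap.range (Q ^ k)).mkQ
        ((LinearMap.range (Q ^ k)).mkQ y).out from (Quotient.out_eq' _).symm)
    obtain ⟨e', he'⟩ := mkQ_eq_mkQ_iff.mp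
      (show (LinearMap.range (Q ^ 1)).mkQ e = (LinearMap.range (Q ^ 1)).mkQ
        ((LinearMap.range (Q ^ 1)).mkQ e).out from (Quotient.out_eq' _).symm)
    refine ⟨(LinearMap.range (Q ^ 1)).mkQ e, mkQ_eq_mkQ_iff.mpr ⟨e', ?_⟩⟩
    rw [pow_add, Module.End.mul_apply, add_assoc, ← map_add, ← he', ← he]
  have hfac : ∀ {x y}, (LinearMap.range (Q ^ (k + 1))).mkQ x =
      (LinearMap.range (Q ^ (k + 1))).mkQ y →
      (LinearMap.range (Q ^ k)).mkQ x = (LinearMap.range (Q ^ k)).mkQ y := by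
    intro x y h
    obtain ⟨z, hz⟩ := mkQ_eq_mkQ_iff.mp h
    exact mkQ_eq_mkQ_iff.mpr ⟨Q z, by rw [hz, pow_succ]; rfl⟩
  have hsub : levelImage Q (k + 1) X ∩ levelImage Q (k + 1) Y ⊆ F '' (s ×ˢ Set.univ) := by
    rintro _ ⟨⟨x, hx, rfl⟩, y, hy, hxy⟩
    obtain ⟨d, hd⟩ := key x
    exact ⟨(_, d), ⟨⟨⟨x, hx, rfl⟩, y, hy, hfac hxy⟩, trivial⟩, hd.symm⟩
  calc cosetCount Q X Y (k + 1) ≤ (F '' (s ×ˢ Set.univ)).ncard :=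
        Set.ncard_le_ncard hsub (Set.toFinite _)
    _ ≤ (s ×ˢ (Set.univ : Set (A ⧸ LinearMap.range (Q ^ 1)))).ncard :=
        Set.ncard_image_le (Set.toFinite _)
    _ = _ := by
        rw [Set.ncard_prod, Set.ncard_univ, card_quotient_range_pow hQ, pow_one]; rfl

theorem tendsto_cosetCount (hQ : Function.Injective Q) (X Y : Set A) :
    Tendsto (fun k : ℕ => (cosetCount Q X Y k : ℝ) / (((LinearMap.det Q).natAbs : ℕ) : ℝ) ^ k)
      atTop (𝓝 (jointDensity Q X Y)) := by
  have hq := natAbs_det_pos hQ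
  refine tendsto_atTop_ciInf (antitone_nat_of_succ_le fun k => ?_)
    ⟨0, by rintro _ ⟨k, rfl⟩; positivity⟩
  rw [div_le_div_iff₀ (by positivity) (by positivity), pow_succ]
  have h : (cosetCount Q X Y (k + 1) : ℝ) ≤
      cosetCount Q X Y k * (((LinearMap.det Q).natAbs : ℕ) : ℝ) := by
    exact_mod_cast cosetCount_succ_le hQ X Y k
  calc _ ≤ (cosetCount Q X Y k * (((LinearMap.det Q).natAbs : ℕ) : ℝ)) *
        (((LinearMap.det Q).natAbs : ℕ) : ℝ) ^ k := by gcongr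
    _ = _ := by ring

omit [Module.Free ℤ A] [Module.Finite ℤ A] in
theorem jointDensity_nonneg (X Y : Set A) : 0 ≤ jointDensity Q X Y :=
  Real.iInf_nonneg fun k => by positivity

theorem jointDensity_univ (hQ : Function.Injective Q) :
    jointDensity Q Set.univ Set.univ = 1 := by
  have hq := natAbs_det_pos hQ
  refine tendsto_nhds_unique (tendsto_cosetCount hQ _ _) (tendsto_const_nhds.congr fun k => ?_)
  have : cosetCount Q Set.univ Set.univ k = (LinearMap.det Q).natAbs ^ k := by
    rw [cosetCount, levelImage, Set.image_univ_of_surjective (Submodule.mkQ_surjective _),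
      Set.inter_self, Set.ncard_univ, card_quotient_range_pow hQ]
  rw [this, Nat.cast_pow, div_self (by positivity)]

omit [Module.Free ℤ A] [Module.Finite ℤ A] in
/-- The map induced on cosets by `x ↦ Q x + a`. -/
theorem exists_affine_levelMap (hQ : Function.Injective Q) {f : A → A} {a : A}
    (hf : ∀ x, f x = Q x + a) (k : ℕ) :
    ∃ F : (A ⧸ LinearMap.range (Q ^ k)) → A ⧸ LinearMap.range (Q ^ (k + 1)),
      Function.Injective F ∧
      ∀ x, F ((LinearMap.range (Q ^ k)).mkQ x) = (LinearMap.range (Q ^ (k + 1))).mkQ (f x) := by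
  have hmk : ∀ x y, (LinearMap.range (Q ^ (k + 1))).mkQ (f x) =
      (LinearMap.range (Q ^ (k + 1))).mkQ (f y) ↔
      (LinearMap.range (Q ^ k)).mkQ x = (LinearMap.range (Q ^ k)).mkQ y := by
    intro x y
    simp only [mkQ_eq_mkQ_iff, hf, pow_succ', Module.End.mul_apply]
    refine exists_congr fun z => ?_
    rw [add_right_comm, add_left_inj, ← map_add, hQ.eq_iff]
  refine ⟨fun w => (LinearMap.range (Q ^ (k + 1))).mkQ (f w.out), fun w w' h => ?_, fun x => ?_⟩
  · rw [← Quotient.out_eq' w, ← Quotient.out_eq' w']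
    exact (hmk _ _).mp h
  · exact (hmk _ _).mpr (Quotient.out_eq' _)

omit [Module.Free ℤ A] [Module.Finite ℤ A] in
theorem cosetCount_image_univ (hQ : Function.Injective Q) {f : A → A} {a : A}
    (hf : ∀ x, f x = Q x + a) (X : Set A) (k : ℕ) :
    cosetCount Q (f '' X) Set.univ (k + 1) = cosetCount Q X Set.univ k := by
  obtain ⟨F, hF, hFf⟩ := exists_affine_levelMap hQ hf k
  have huniv : ∀ l, levelImage Q l Set.univ = Set.univ := fun l =>
    Set.image_univ_of_surjective (Submodule.mkQ_surjective _)
  rw [cosetCount, cosetCount, huniv, huniv, Set.inter_univ, Set.inter_univ,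
    ← Set.ncard_image_of_injective _ hF]
  congr 1
  simp only [levelImage, Set.image_image, hFf]

theorem cosetCount_image_compl_le (hQ : Function.Injective Q) {f : A → A} {a : A}
    (hf : ∀ x, f x = Q x + a) (X : Set A) (k : ℕ) :
    cosetCount Q (f '' X) (f '' X)ᶜ (k + 1) ≤ cosetCount Q X Xᶜ k := by
  have := finite_quotient_range_pow hQ
  obtain ⟨F, hF, hFf⟩ := exists_affine_levelMap hQ hf k
  rw [cosetCount, cosetCount, ← Set.ncard_image_of_injective _ hF]
  refine Set.ncard_le_ncard ?_ (Set.toFinite _)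
  rintro _ ⟨⟨_, ⟨x, hx, rfl⟩, rfl⟩, y, hy, hxy⟩
  refine ⟨(LinearMap.range (Q ^ k)).mkQ x, ⟨⟨x, hx, rfl⟩, ?_⟩, hFf x⟩
  -- The point `y` shares a coset of `Q ^ (k + 1) A` with `f x`, so `y = f (x + Q ^ k w)`; being
  -- outside `f '' X`, it comes from a point outside `X`.
  obtain ⟨w, hw⟩ := mkQ_eq_mkQ_iff.mp hxy
  refine ⟨x + (Q ^ k) w, fun hmem => hy ⟨_, hmem, ?_⟩, mkQ_eq_mkQ_iff.mpr ⟨w, rfl⟩⟩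
  rw [hw, hf, hf, map_add, pow_succ', Module.End.mul_apply, add_right_comm]

theorem jointDensity_image_univ (hQ : Function.Injective Q) {f : A → A} {a : A}
    (hf : ∀ x, f x = Q x + a) (X : Set A) :
    jointDensity Q (f '' X) Set.univ =
      jointDensity Q X Set.univ / (((LinearMap.det Q).natAbs : ℕ) : ℝ) := by
  refine tendsto_nhds_unique ((tendsto_add_atTop_iff_nat 1).mpr (tendsto_cosetCount hQ _ _))
    (((tendsto_cosetCount hQ X Set.univ).div_const _).congr fun k => ?_)
  rw [cosetCount_image_univ hQ hf, pow_succ, div_div]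

theorem jointDensity_image_compl_le (hQ : Function.Injective Q) {f : A → A} {a : A}
    (hf : ∀ x, f x = Q x + a) (X : Set A) :
    jointDensity Q (f '' X) (f '' X)ᶜ ≤
      jointDensity Q X Xᶜ / (((LinearMap.det Q).natAbs : ℕ) : ℝ) := by
  have hq := natAbs_det_pos hQ
  refine le_of_tendsto_of_tendsto'
    ((tendsto_add_atTop_iff_nat 1).mpr (tendsto_cosetCount hQ _ _))
    ((tendsto_cosetCount hQ X Xᶜ).div_const _) fun k => ?_
  rw [div_div, ← pow_succ]
  gcongr
  exact cosetCount_image_compl_le hQ hf X k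

/-- Inclusion–exclusion at each level. A coset meeting both `X` and `Y` meets `X` and its
complement, so the correction term is bounded by the boundary of `X`, which is null. -/
theorem jointDensity_union_of_disjoint (hQ : Function.Injective Q) {X Y : Set A}
    (hXY : Disjoint X Y) (hX : jointDensity Q X Xᶜ = 0) :
    jointDensity Q (X ∪ Y) Set.univ = jointDensity Q X Set.univ + jointDensity Q Y Set.univ := by
  have := finite_quotient_range_pow hQ
  have hq := natAbs_det_pos hQ
  have huniv : ∀ k, levelImage Q k Set.univ = Set.univ := fun l =>
    Set.image_univ_of_surjective (Submodule.mkQ_surjective _)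
  have hcount : ∀ k, cosetCount Q (X ∪ Y) Set.univ k + cosetCount Q X Y k =
      cosetCount Q X Set.univ k + cosetCount Q Y Set.univ k := fun k => by
    simp only [cosetCount, huniv, Set.inter_univ]
    rw [levelImage, Set.image_union]
    exact Set.ncard_union_add_ncard_inter _ _
  have hzero : jointDensity Q X Y = 0 := by
    refine le_antisymm (hX ▸ ?_) (jointDensity_nonneg _ _)
    refine le_of_tendsto_of_tendsto' (tendsto_cosetCount hQ _ _) (tendsto_cosetCount hQ _ _)
      fun k => ?_
    gcongr
    exact Set.ncard_le_ncard (Set.inter_subset_inter_right _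
      (Set.image_mono hXY.subset_compl_left)) (Set.toFinite _)
  have h := tendsto_nhds_unique
    (((tendsto_cosetCount hQ X Set.univ).add (tendsto_cosetCount hQ Y Set.univ)).congr fun k => by
      rw [← add_div, ← Nat.cast_add, ← hcount, Nat.cast_add, add_div])
    ((tendsto_cosetCount hQ (X ∪ Y) Set.univ).add (tendsto_cosetCount hQ X Y))
  rw [h, hzero, add_zero]

omit [Module.Free ℤ A] [Module.Finite ℤ A] in
theorem jointDensity_empty (Y : Set A) : jointDensity Q ∅ Y = 0 := by
  simp [jointDensity, cosetCount, levelImage]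

theorem jointDensity_biUnion_of_disjoint (hQ : Function.Injective Q) {ι : Type*} (t : Finset ι)
    (X : ι → Set A) (hdis : (t : Set ι).PairwiseDisjoint X)
    (hX : ∀ s ∈ t, jointDensity Q (X s) (X s)ᶜ = 0) :
    jointDensity Q (⋃ s ∈ t, X s) Set.univ = ∑ s ∈ t, jointDensity Q (X s) Set.univ := by
  classical
  induction t using Finset.induction_on with
  | empty => simp [jointDensity_empty]
  | insert s t hs ih =>
    rw [Finset.set_biUnion_insert, jointDensity_union_of_disjoint hQ _ (hX s (by simp)),
      Finset.sum_insert hs, ih (hdis.subset (by simp)) fun r hr => hX r (by simp [hr])]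
    refine Set.disjoint_iUnion₂_right.mpr fun r hr => hdis (by simp) (by simp [hr]) ?_
    rintro rfl
    exact hs hr

/-- Outside cosets of `Q A` contained in `Z`, the boundary of a finite union `Z` lies in the
boundaries of its pieces. -/
theorem jointDensity_compl_le_sum (hQ : Function.Injective Q) {ι : Type*} (t : Finset ι)
    (X : ι → Set A) {Z : Set A} (hXZ : ∀ s ∈ t, X s ⊆ Z)
    (hZ : ∀ x ∈ Z, (∃ s ∈ t, x ∈ X s) ∨ ∀ y, x + Q y ∈ Z) :
    jointDensity Q Z Zᶜ ≤ ∑ s ∈ t, jointDensity Q (X s) (X s)ᶜ := by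
  have := finite_quotient_range_pow hQ
  have hq := natAbs_det_pos hQ
  refine le_of_tendsto_of_tendsto'
    ((tendsto_add_atTop_iff_nat 1).mpr (tendsto_cosetCount hQ _ _))
    (tendsto_finsetSum t fun s _ =>
      (tendsto_add_atTop_iff_nat 1).mpr (tendsto_cosetCount hQ _ _)) fun k => ?_
  rw [← Finset.sum_div]
  gcongr
  have hsub : levelImage Q (k + 1) Z ∩ levelImage Q (k + 1) Zᶜ ⊆
      ⋃ s ∈ t, levelImage Q (k + 1) (X s) ∩ levelImage Q (k + 1) (X s)ᶜ := by
    rintro _ ⟨⟨x, hx, rfl⟩, y, hy, hyx⟩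
    obtain ⟨w, hw⟩ := mkQ_eq_mkQ_iff.mp hyx
    rcases hZ x hx with ⟨s, hs, hxs⟩ | h
    · exact Set.mem_biUnion hs ⟨⟨x, hxs, rfl⟩, y, fun hys => hy (hXZ s hs hys), hyx⟩
    -- At level `k + 1` the points `x` and `y` differ by an element of `Q A`, so `y` would lie in
    -- `Z` too.
    · refine absurd ?_ hy
      rw [hw, pow_succ', Module.End.mul_apply]
      exact h _
  exact_mod_cast (Set.ncard_le_ncard hsub (Set.toFinite _)).trans
    (Finset.set_ncard_biUnion_le t _)

end FreeFinite

end Density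

/-! ### Perron-Frobenius comparison -/

/-- Let `S` be positive with PF-eigenvalue `r`. A non-negative vector `b` with `r b ≤ S b` and with
`r b i₀ + b j₀ ≤ (S b) i₀` for some `i₀`, `j₀` is zero. -/
theorem IsPFPair.eq_zero_of_strict_subinvariant {m : ℕ} {S : Matrix (Fin m) (Fin m) ℝ} {r : ℝ}
    {v b : Fin m → ℝ} (h : IsPFPair S r v) (hS : ∀ i j, 0 < S i j) (hb : ∀ i, 0 ≤ b i)
    (hle : ∀ i, r * b i ≤ S.mulVec b i) {i₀ j₀ : Fin m}
    (hlt : r * b i₀ + b j₀ ≤ S.mulVec b i₀) (j : Fin m) : b j = 0 := by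
  have hv := h.pos
  -- For the maximal ratio `t`, the vector `t • v - b` is non-negative, yet row `i` of `S` sends it
  -- to a number `≤ 0`; positivity of that row forces `b = t • v`.
  obtain ⟨i, -, hi⟩ := Finset.exists_max_image Finset.univ (fun i => b i / v i) ⟨i₀, by simp⟩
  set t := b i / v i with ht
  have ht0 : 0 ≤ t := div_nonneg (hb i) (hv i).le
  have hu : ∀ j, 0 ≤ t * v j - b j := fun j =>
    sub_nonneg.mpr ((div_le_iff₀ (hv j)).mp (hi j (by simp)))
  have hti : b i = t * v i := by rw [ht, div_mul_cancel₀ _ (hv i).ne']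
  have hSv : ∀ i, S.mulVec v i = r * v i := fun i => by rw [h.eigen]; rfl
  have hSu : ∀ i, S.mulVec (t • v - b) i = t * (r * v i) - S.mulVec b i := fun i => by
    rw [Matrix.mulVec_sub, Matrix.mulVec_smul, Pi.sub_apply, Pi.smul_apply, hSv, smul_eq_mul]
  have hsum : S.mulVec (t • v - b) i ≤ 0 := by
    rw [hSu]
    have := hle i
    rw [hti] at this
    linarith
  have hzero : ∀ j, t * v j = b j := fun j => by
    have hterm : ∀ j ∈ Finset.univ, 0 ≤ S i j * (t • v - b) j := fun j _ =>
      mul_nonneg (hS i j).le (hu j)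
    have := (Finset.sum_eq_zero_iff_of_nonneg hterm).mp
      (le_antisymm hsum (Finset.sum_nonneg hterm)) j (by simp)
    rcases mul_eq_zero.mp this with h0 | h0
    · exact absurd h0 (hS i j).ne'
    · exact sub_eq_zero.mp h0
  have hbv : b = t • v := funext fun j => (hzero j).symm
  -- Now `S b = r b`, so the inequality at `i₀` leaves no room for a positive `b j₀`.
  have hj₀ : b j₀ ≤ 0 := by
    have hSb : S.mulVec b i₀ = r * b i₀ := by
      rw [hbv, Matrix.mulVec_smul, Pi.smul_apply, Pi.smul_apply, hSv, smul_eq_mul, smul_eq_mul]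
      ring
    linarith
  have : t = 0 := by
    rw [← hzero j₀] at hj₀
    exact le_antisymm (nonpos_of_mul_nonpos_left hj₀ (hv j₀)) ht0
  rw [← hzero j, this, zero_mul]

/-! ### Pieces of a substitution system -/

section Pieces

variable {A : Type*} [AddCommGroup A] {m : ℕ} {Q : Module.End ℤ A} {U : Fin m → Set A}
  {Φ : MFS m A}

namespace IsSubstitutionSystem

theorem mem_iff (h : IsSubstitutionSystem Q U Φ) {i : Fin m} {x : A} :
    x ∈ U i ↔ ∃ j, ∃ f ∈ Φ i j, ∃ y ∈ U j, f y = x := by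
  conv_lhs => rw [← h.fixed]
  simp [MFS.apply]

theorem image_subset (h : IsSubstitutionSystem Q U Φ) {i j : Fin m} {f : A → A} (hf : f ∈ Φ i j) :
    f '' U j ⊆ U i := by
  rintro _ ⟨y, hy, rfl⟩
  exact h.mem_iff.mpr ⟨j, f, hf, y, hy, rfl⟩

/-- The maps in row `i`, with their columns. -/
noncomputable def row (h : IsSubstitutionSystem Q U Φ) (i : Fin m) :
    Finset ((_ : Fin m) × (A → A)) :=
  Finset.univ.sigma fun j => (h.finite i j).toFinset

theorem mem_row (h : IsSubstitutionSystem Q U Φ) {i : Fin m} {p : (_ : Fin m) × (A → A)} :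
    p ∈ h.row i ↔ p.2 ∈ Φ i p.1 := by
  simp [row]

theorem sum_row (h : IsSubstitutionSystem Q U Φ) (i : Fin m) (c : Fin m → ℝ) :
    ∑ p ∈ h.row i, c p.1 = Φ.substMatrix.mulVec c i := by
  rw [row, Finset.sum_sigma]
  refine Finset.sum_congr rfl fun j _ => ?_
  refine (Finset.sum_const (c j)).trans ?_
  rw [nsmul_eq_mul, ← Set.ncard_eq_toFinset_card _ (h.finite i j)]
  rfl

variable [Module.Free ℤ A] [Module.Finite ℤ A]

/-- If the sets `U j` have boundaries of measure zero, their densities form an eigenvector of the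
substitution matrix. -/
theorem mulVec_density (h : IsSubstitutionSystem Q U Φ)
    (hU : ∀ j, jointDensity Q (U j) (U j)ᶜ = 0) :
    Φ.substMatrix.mulVec (fun j => jointDensity Q (U j) Set.univ) =
      (((LinearMap.det Q).natAbs : ℕ) : ℝ) • fun j => jointDensity Q (U j) Set.univ := by
  have hQ := h.inflation.injective
  have hq := natAbs_det_pos hQ
  funext i
  have hUi : U i = ⋃ p ∈ h.row i, p.2 '' U p.1 := by
    ext x
    rw [h.mem_iff]
    simp [mem_row, Sigma.exists]
  have hdis : (h.row i : Set ((_ : Fin m) × (A → A))).PairwiseDisjoint fun p => p.2 '' U p.1 := by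
    intro p hp p' hp' hne
    refine h.disjoint_images i _ _ _ (h.mem_row.mp hp) _ (h.mem_row.mp hp') fun heq => hne ?_
    obtain ⟨j, f⟩ := p
    obtain ⟨j', f'⟩ := p'
    obtain ⟨rfl, rfl⟩ := Prod.mk.inj heq
    rfl
  have hzero : ∀ p ∈ h.row i, jointDensity Q (p.2 '' U p.1) (p.2 '' U p.1)ᶜ = 0 := by
    intro p hp
    obtain ⟨a, ha⟩ := h.affine _ _ _ (h.mem_row.mp hp)
    refine le_antisymm ((jointDensity_image_compl_le hQ ha _).trans ?_) (jointDensity_nonneg _ _)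
    rw [hU, zero_div]
  rw [Pi.smul_apply, smul_eq_mul, ← h.sum_row]
  conv_rhs => rw [hUi, jointDensity_biUnion_of_disjoint hQ _ _ hdis hzero]
  rw [Finset.mul_sum]
  refine Finset.sum_congr rfl fun p hp => ?_
  obtain ⟨a, ha⟩ := h.affine _ _ _ (h.mem_row.mp hp)
  rw [jointDensity_image_univ hQ ha, mul_div_cancel₀ _ hq.ne']

/-- The boundary of `U i` comes from the boundaries of its pieces `f '' U j`, each at most `1 / |det
Q|` times that of `U j`. A map outside `t` contributes nothing: the full coset of `Q A` around its
image lies in `U i`. -/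
theorem boundary_row_le (h : IsSubstitutionSystem Q U Φ) (i : Fin m)
    (t : Finset ((_ : Fin m) × (A → A))) (ht : t ⊆ h.row i)
    (hi : ∀ p ∈ h.row i, p ∉ t → Set.range p.2 ⊆ U i) :
    (((LinearMap.det Q).natAbs : ℕ) : ℝ) * jointDensity Q (U i) (U i)ᶜ ≤
      ∑ p ∈ t, jointDensity Q (U p.1) (U p.1)ᶜ := by
  have hQ := h.inflation.injective
  have hq := natAbs_det_pos hQ
  have hle := jointDensity_compl_le_sum hQ t (fun p => p.2 '' U p.1) (Z := U i)
    (fun p hp => h.image_subset (h.mem_row.mp (ht hp))) fun x hx => by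
      obtain ⟨j, f, hf, y, hy, rfl⟩ := h.mem_iff.mp hx
      by_cases hp : (⟨j, f⟩ : (_ : Fin m) × (A → A)) ∈ t
      · exact Or.inl ⟨_, hp, y, hy, rfl⟩
      · refine Or.inr fun z => hi ⟨j, f⟩ (h.mem_row.mpr hf) hp ⟨y + z, ?_⟩
        obtain ⟨a, ha⟩ := h.affine _ _ _ hf
        simp only [ha, map_add]
        abel
  calc _ ≤ (((LinearMap.det Q).natAbs : ℕ) : ℝ) *
        ∑ p ∈ t, jointDensity Q (p.2 '' U p.1) (p.2 '' U p.1)ᶜ := by gcongr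
    _ ≤ _ := by
      rw [Finset.mul_sum]
      refine Finset.sum_le_sum fun p hp => ?_
      obtain ⟨a, ha⟩ := h.affine _ _ _ (h.mem_row.mp (ht hp))
      exact (mul_le_mul_of_nonneg_left (jointDensity_image_compl_le hQ ha _) hq.le).trans_eq
        (mul_div_cancel₀ _ hq.ne')

/-- If some `U i` contains a coset of `Q A`, then all `U j` have boundary of measure zero. -/
theorem boundary_eq_zero (h : IsSubstitutionSystem Q U Φ) (hpos : ∀ i j, 0 < Φ.substMatrix i j)
    {v : Fin m → ℝ} (hv : IsPFPair Φ.substMatrix (((LinearMap.det Q).natAbs : ℕ) : ℝ) v)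
    {i : Fin m} {a : A} (ha : ∀ x, a + Q x ∈ U i) (j : Fin m) :
    jointDensity Q (U j) (U j)ᶜ = 0 := by
  classical
  -- The map `f` covering the point `a` has range `a + Q A`, which lies in `U i`; its term can be
  -- erased from row `i`, giving the strict inequality.
  obtain ⟨j₀, f, hf, y, -, hy⟩ := h.mem_iff.mp (by simpa using ha 0)
  refine hv.eq_zero_of_strict_subinvariant (b := fun j => jointDensity Q (U j) (U j)ᶜ) hpos
    (fun j => jointDensity_nonneg _ _) (fun i => ?_) (i₀ := i) (j₀ := j₀) ?_ j
  · rw [← h.sum_row]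
    exact h.boundary_row_le i _ subset_rfl fun p hp hp' => absurd hp hp'
  · rw [← h.sum_row, ← Finset.sum_erase_add _ _ (h.mem_row.mpr hf : ⟨j₀, f⟩ ∈ h.row i)]
    refine add_le_add_left (h.boundary_row_le i _ (Finset.erase_subset _ _) fun p hp hp' => ?_) _
    obtain rfl : p = ⟨j₀, f⟩ := by
      by_contra hne
      exact hp' (Finset.mem_erase.mpr ⟨hne, hp⟩)
    rintro _ ⟨x, rfl⟩
    obtain ⟨b, hb⟩ := h.affine _ _ _ hf
    have : f x = a + Q (x - y) := by rw [← hy, hb, hb, map_sub]; abel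
    simpa only [this] using ha (x - y)

end IsSubstitutionSystem

end Pieces

/-! ### Merging a monochromatic congruence class -/

section Merge

variable {A : Type*} [AddCommGroup A] {m : ℕ} {Q : Module.End ℤ A} {U : Fin m → Set A}
  {Φ : MFS m A}

/-- In row `i`, replace all maps with translational part congruent to `a` by the map
`x ↦ a + Q x`, which is put into every entry. -/
def MFS.mergeClass (Q : Module.End ℤ A) (Φ : MFS m A) (i : Fin m) (a : A) : MFS m A := fun k j =>
  {f | (f ∈ Φ k j ∧ (k = i → f 0 - a ∉ LinearMap.range Q)) ∨ (k = i ∧ f = fun x => a + Q x)}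

theorem MFS.mergeClass_admitsCoincidence (Q : Module.End ℤ A) (Φ : MFS m A) (i : Fin m) (a : A) :
    (Φ.mergeClass Q i a).AdmitsCoincidence :=
  ⟨i, fun x => a + Q x, Set.mem_iInter.mpr fun _ => Or.inr ⟨rfl, rfl⟩⟩

namespace IsSubstitutionSystem

/-- The deleted maps have images inside `a + Q A ⊆ U i`. Since the `U j` partition `A`, the sets `a
+ Q (U j)` partition that coset, and the maps kept in row `i` have images that avoid it. -/
theorem mergeClass [Module.Free ℤ A] [Module.Finite ℤ A] (h : IsSubstitutionSystem Q U Φ)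
    (hcover : ⋃ i, U i = Set.univ) {i : Fin m} {a : A} (ha : ∀ x, a + Q x ∈ U i) :
    IsSubstitutionSystem Q U (Φ.mergeClass Q i a) where
  inflation := h.inflation
  disjoint := h.disjoint
  finite k j := ((h.finite k j).union (Set.finite_singleton fun x => a + Q x)).subset <| by
    rintro f (⟨hf, -⟩ | ⟨-, hf⟩)
    · exact Or.inl hf
    · exact Or.inr hf
  affine k j f hf := by
    rcases hf with ⟨hf, -⟩ | ⟨-, rfl⟩
    · exact h.affine _ _ _ hf
    · exact ⟨a, fun x => add_comm _ _⟩
  fixed := by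
    funext k
    ext x
    simp only [MFS.apply, Set.mem_iUnion, Set.mem_image, exists_prop]
    constructor
    · rintro ⟨j, f, ⟨hf, -⟩ | ⟨rfl, rfl⟩, y, hy, rfl⟩
      · exact h.mem_iff.mpr ⟨j, f, hf, y, hy, rfl⟩
      · exact ha y
    · intro hx
      obtain ⟨j, f, hf, y, hy, rfl⟩ := h.mem_iff.mp hx
      by_cases hc : k = i → f 0 - a ∉ LinearMap.range Q
      · exact ⟨j, f, Or.inl ⟨hf, hc⟩, y, hy, rfl⟩
      · push Not at hc
        obtain ⟨hk, z, hz⟩ := hc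
        -- Here `f y = a + Q (y + z)`, so the merged map reaches this point from whichever column
        -- contains `y + z`.
        obtain ⟨j', hj'⟩ := Set.mem_iUnion.mp (hcover.symm ▸ Set.mem_univ (y + z))
        refine ⟨j', _, Or.inr ⟨hk, rfl⟩, y + z, hj', ?_⟩
        obtain ⟨b, hb⟩ := h.affine _ _ _ hf
        rw [hb, map_zero, zero_add] at hz
        rw [hb, map_add, hz]
        abel
  disjoint_images := by
    have hmixed : ∀ {k j : Fin m} {f : A → A}, f ∈ Φ k j → f 0 - a ∉ LinearMap.range Q →
        ∀ X Y : Set A, Disjoint (f '' X) ((fun x => a + Q x) '' Y) := by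
      intro k j f hf hfa X Y
      obtain ⟨b, hb⟩ := h.affine _ _ _ hf
      rw [Set.disjoint_left]
      rintro _ ⟨x, -, rfl⟩ ⟨y, -, hxy⟩
      refine hfa ⟨y - x, ?_⟩
      simp only [hb] at hxy
      rw [hb, map_zero, zero_add, map_sub, sub_eq_sub_iff_add_eq_add, add_comm, hxy, add_comm]
    intro k j j' f hf f' hf' hne
    rcases hf with ⟨hf, hfa⟩ | ⟨hk, rfl⟩ <;> rcases hf' with ⟨hf', hfa'⟩ | ⟨hk', rfl⟩
    · exact h.disjoint_images k j j' f hf f' hf' hne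
    · exact hmixed hf (hfa hk') _ _
    · exact (hmixed hf' (hfa' hk) _ _).symm
    · refine (Set.disjoint_image_iff fun x y hxy => ?_).mpr
        (h.disjoint fun hj => hne (by rw [hj]))
      exact h.inflation.injective (add_left_cancel hxy)

theorem substMatrix_mergeClass_pos [Module.Free ℤ A] [Module.Finite ℤ A]
    (h : IsSubstitutionSystem Q U Φ) (hcover : ⋃ i, U i = Set.univ)
    (hpos : ∀ i j, 0 < Φ.substMatrix i j) {i : Fin m} {a : A} (ha : ∀ x, a + Q x ∈ U i)
    (k j : Fin m) : 0 < (Φ.mergeClass Q i a).substMatrix k j := by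
  refine Nat.cast_pos.mpr
    ((Set.ncard_pos ((h.mergeClass hcover ha).finite k j)).mpr ?_)
  by_cases hk : k = i
  · exact ⟨_, Or.inr ⟨hk, rfl⟩⟩
  · obtain ⟨f, hf⟩ := Set.nonempty_of_ncard_ne_zero (Nat.cast_pos.mp (hpos k j)).ne'
    exact ⟨f, Or.inl ⟨hf, fun hk' => absurd hk' hk⟩⟩

/-- The densities depend only on `Q` and `U`, so they form an eigenvector for `Φ` and for the merged
system alike. -/
theorem exists_equivalent_coincidence [Module.Free ℤ A] [Module.Finite ℤ A]
    (h : IsSubstitutionSystem Q U Φ) (hcover : ⋃ i, U i = Set.univ)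
    (hpos : ∀ i j, 0 < Φ.substMatrix i j)
    (hPF : IsPFEigenvalue Φ.substMatrix (((LinearMap.det Q).natAbs : ℕ) : ℝ))
    {i : Fin m} {a : A} (ha : ∀ x, a + Q x ∈ U i) :
    ∃ Ψ : MFS m A, Ψ.IsPrimitive ∧ Ψ.AdmitsCoincidence ∧ EquivalentSystems Q U Ψ Q U Φ := by
  obtain ⟨v, hv⟩ := hPF
  have hQ := h.inflation.injective
  have hb := h.boundary_eq_zero hpos hv ha
  set d : Fin m → ℝ := fun j => jointDensity Q (U j) Set.univ with hd
  have hd0 : ∀ j, 0 ≤ d j := fun j => jointDensity_nonneg _ _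
  have heig := h.mulVec_density hb
  have hsum : ∑ j, d j = 1 := by
    rw [← jointDensity_univ hQ, ← jointDensity_biUnion_of_disjoint hQ Finset.univ U
      (fun j _ j' _ hj => h.disjoint hj) fun j _ => hb j]
    simp [hcover]
  have hdpos : ∀ j, 0 < d j := by
    intro j
    -- If `d j` vanished, row `j` of `S d = q d` with `S` positive would make all densities vanish,
    -- although they sum to `1`.
    refine lt_of_le_of_ne (hd0 j) fun hj => ?_
    have hrow : ∑ l, Φ.substMatrix j l * d l = 0 := by
      have := congrFun heig j
      rw [Pi.smul_apply, smul_eq_mul] at this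
      exact this.trans (mul_eq_zero_of_right _ hj.symm)
    have hall := (Finset.sum_eq_zero_iff_of_nonneg
      fun l _ => mul_nonneg (hpos j l).le (hd0 l)).mp hrow
    have : ∑ l, d l = 0 := Finset.sum_eq_zero fun l hl =>
      (mul_eq_zero.mp (hall l hl)).resolve_left (hpos j l).ne'
    linarith
  have hΨ := h.mergeClass hcover ha
  have hΨpos := h.substMatrix_mergeClass_pos hcover hpos ha
  refine ⟨Φ.mergeClass Q i a, ⟨fun k j => (hΨpos k j).le, 1, one_pos, by simpa using hΨpos⟩,
    Φ.mergeClass_admitsCoincidence Q i a, hΨ, h, rfl, rfl,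
    _, d, ⟨hdpos, hΨ.mulVec_density hb⟩, hdpos, heig⟩

end IsSubstitutionSystem

end Merge

/-! ### Iterates -/

section Iterates

variable {A : Type*} [AddCommGroup A] {m : ℕ} {Q : Module.End ℤ A} {U : Fin m → Set A}
  {Φ : MFS m A}

theorem IsInflation.pow (hQ : IsInflation Q) {N : ℕ} (hN : 0 < N) : IsInflation (Q ^ N) where
  det_ne_zero := by
    rw [map_pow]
    exact pow_ne_zero _ hQ.det_ne_zero
  iInf_range := by
    have hanti : Antitone fun k : ℕ => LinearMap.range (Q ^ k) :=
      antitone_nat_of_succ_le (range_pow_succ_le Q)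
    rw [eq_bot_iff, ← hQ.iInf_range]
    refine le_iInf fun k => (iInf_le _ k).trans ?_
    rw [← pow_mul]
    exact hanti (Nat.le_mul_of_pos_left k hN)

omit [AddCommGroup A] in
theorem MFS.apply_one (U : Fin m → Set A) : (MFS.one : MFS m A).apply U = U := by
  funext i
  ext x
  simp only [MFS.apply, MFS.one, Set.mem_iUnion, Set.mem_image, exists_prop, Set.mem_ofPred_eq]
  constructor
  · rintro ⟨j, f, ⟨rfl, rfl⟩, y, hy, rfl⟩
    exact hy
  · exact fun hx => ⟨i, id, ⟨rfl, rfl⟩, x, hx, rfl⟩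

omit [AddCommGroup A] in
theorem MFS.apply_comp (Ψ Φ : MFS m A) (U : Fin m → Set A) :
    (Ψ.comp Φ).apply U = Ψ.apply (Φ.apply U) := by
  funext i
  ext x
  simp only [MFS.apply, MFS.comp, Set.mem_iUnion, Set.mem_image, exists_prop, Set.mem_ofPred_eq]
  constructor
  · rintro ⟨j, _, ⟨k, g, hg, f, hf, rfl⟩, y, hy, rfl⟩
    exact ⟨k, g, hg, f y, ⟨j, f, hf, y, hy, rfl⟩, rfl⟩
  · rintro ⟨k, g, hg, _, ⟨j, f, hf, y, hy, rfl⟩, rfl⟩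
    exact ⟨j, g ∘ f, ⟨k, g, hg, f, hf, rfl⟩, y, hy, rfl⟩

omit [AddCommGroup A] in
-- Distinct compositions may coincide as maps, so without disjointness the power of the matrix need
-- not count the iterate; positivity of an entry still yields a chain of maps.
theorem MFS.iter_nonempty_of_pos (Φ : MFS m A) :
    ∀ (k : ℕ) (i j : Fin m), 0 < (Φ.substMatrix ^ k) i j → (Φ.iter k i j).Nonempty
  | 0, i, j, hij => by
    obtain rfl : i = j := by
      by_contra hne
      simp [Matrix.one_apply_ne hne] at hij
    exact ⟨id, rfl, rfl⟩
  | k + 1, i, j, hij => by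
    rw [pow_succ, Matrix.mul_apply] at hij
    have hS : ∀ i j, 0 ≤ Φ.substMatrix i j := fun i j => Nat.cast_nonneg _
    have hSk : ∀ (k : ℕ) i j, 0 ≤ (Φ.substMatrix ^ k) i j := by
      intro k
      induction k with
      | zero => intro i j; rw [pow_zero, Matrix.one_apply]; positivity
      | succ k ih =>
        intro i j
        rw [pow_succ, Matrix.mul_apply]
        exact Finset.sum_nonneg fun l _ => mul_nonneg (ih i l) (hS l j)
    obtain ⟨l, -, hl⟩ := Finset.exists_ne_zero_of_sum_ne_zero hij.ne'
    have hl1 := lt_of_le_of_ne (hSk k i l) (left_ne_zero_of_mul hl).symm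
    have hl2 := lt_of_le_of_ne (hS l j) (right_ne_zero_of_mul hl).symm
    obtain ⟨g, hg⟩ := Φ.iter_nonempty_of_pos k i l hl1
    obtain ⟨f, hf⟩ := Set.nonempty_of_ncard_ne_zero (Nat.cast_pos.mp hl2).ne'
    exact ⟨g ∘ f, l, g, hg, f, hf, rfl⟩

namespace IsSubstitutionSystem

theorem iter_fixed (h : IsSubstitutionSystem Q U Φ) : ∀ k, (Φ.iter k).apply U = U
  | 0 => MFS.apply_one U
  | k + 1 => by rw [MFS.iter, MFS.apply_comp, h.fixed, h.iter_fixed k]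

theorem iter_affine (h : IsSubstitutionSystem Q U Φ) :
    ∀ (k : ℕ) (i j : Fin m), ∀ f ∈ Φ.iter k i j, ∃ a : A, ∀ x, f x = (Q ^ k) x + a
  | 0, i, j, f, hf => ⟨0, fun x => by rw [hf.2]; simp⟩
  | k + 1, i, j, _, ⟨l, g, hg, f, hf, rfl⟩ => by
    obtain ⟨a, ha⟩ := h.iter_affine k i l g hg
    obtain ⟨b, hb⟩ := h.affine l j f hf
    refine ⟨(Q ^ k) b + a, fun x => ?_⟩
    rw [Function.comp_apply, ha, hb, map_add, pow_succ, Module.End.mul_apply, add_assoc]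

theorem iter_finite (h : IsSubstitutionSystem Q U Φ) :
    ∀ (k : ℕ) (i j : Fin m), (Φ.iter k i j).Finite
  | 0, _, _ => (Set.finite_singleton id).subset fun _ hf => hf.2
  | k + 1, i, j => by
    refine (Set.finite_iUnion fun l => (h.iter_finite k i l).image2 (fun g f => g ∘ f)
      (h.finite l j)).subset ?_
    rintro _ ⟨l, g, hg, f, hf, rfl⟩
    exact Set.mem_iUnion.mpr ⟨l, g, hg, f, hf, rfl⟩

/-- Different outer maps already have disjoint images; for equal outer maps, injectivity reduces to
the inner ones. -/
theorem iter_disjoint_images (h : IsSubstitutionSystem Q U Φ) (hQ : Function.Injective Q) :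
    ∀ (k : ℕ) (i j j' : Fin m), ∀ f ∈ Φ.iter k i j, ∀ f' ∈ Φ.iter k i j', (j, f) ≠ (j', f') →
      Disjoint (f '' U j) (f' '' U j')
  | 0, i, j, j', f, hf, f', hf', hne => by
    obtain ⟨rfl, rfl⟩ := hf
    obtain ⟨rfl, rfl⟩ := hf'
    exact absurd rfl hne
  | k + 1, i, j, j', _, ⟨l, g, hg, f, hf, rfl⟩, _, ⟨l', g', hg', f', hf', rfl⟩, hne => by
    rw [Set.image_comp, Set.image_comp]
    by_cases heq : (l, g) = (l', g')
    · obtain ⟨rfl, rfl⟩ := Prod.mk.inj heq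
      obtain ⟨a, ha⟩ := h.iter_affine k i l g hg
      have hinj : Function.Injective g := fun x y hxy => by
        rw [ha, ha] at hxy
        exact pow_injective_of_injective hQ k (add_right_cancel hxy)
      refine (Set.disjoint_image_iff hinj).mpr (h.disjoint_images l j j' f hf f' hf' fun hff => ?_)
      obtain ⟨rfl, rfl⟩ := Prod.mk.inj hff
      exact hne rfl
    · exact (h.iter_disjoint_images hQ k i l l' g hg g' hg' heq).mono
        (Set.image_mono (h.image_subset hf)) (Set.image_mono (h.image_subset hf'))

theorem iter [Module.Free ℤ A] [Module.Finite ℤ A] (h : IsSubstitutionSystem Q U Φ) {N : ℕ}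
    (hN : 0 < N) : IsSubstitutionSystem (Q ^ N) U (Φ.iter N) where
  inflation := h.inflation.pow hN
  disjoint := h.disjoint
  finite := h.iter_finite N
  affine := h.iter_affine N
  fixed := h.iter_fixed N
  disjoint_images := h.iter_disjoint_images h.inflation.injective N

theorem nonempty (h : IsSubstitutionSystem Q U Φ) (hprim : Φ.IsPrimitive)
    (hcover : ⋃ i, U i = Set.univ) (i : Fin m) : (U i).Nonempty := by
  obtain ⟨k, -, hk⟩ := hprim.exists_pos_pow
  obtain ⟨j, hj⟩ := Set.mem_iUnion.mp (hcover.symm ▸ Set.mem_univ (0 : A))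
  obtain ⟨f, hf⟩ := Φ.iter_nonempty_of_pos k i j (hk i j)
  refine ⟨f 0, ?_⟩
  rw [← h.iter_fixed k]
  exact Set.mem_iUnion.mpr ⟨j, Set.mem_iUnion₂.mpr ⟨f, hf, 0, hj, rfl⟩⟩

theorem substMatrix_iter (h : IsSubstitutionSystem Q U Φ) (hQ : Function.Injective Q)
    (hU : ∀ i, (U i).Nonempty) : ∀ k, (Φ.iter k).substMatrix = Φ.substMatrix ^ k
  | 0 => by
    ext i j
    rw [pow_zero, Matrix.one_apply]
    split_ifs with hij
    · have : Φ.iter 0 i j = {id} := by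
        ext f
        exact ⟨fun hf => hf.2, fun hf => ⟨hij, hf⟩⟩
      change (((Φ.iter 0 i j).ncard : ℕ) : ℝ) = 1
      rw [this, Set.ncard_singleton, Nat.cast_one]
    · have : Φ.iter 0 i j = ∅ := Set.eq_empty_of_forall_notMem fun f hf => hij hf.1
      change (((Φ.iter 0 i j).ncard : ℕ) : ℝ) = 0
      rw [this, Set.ncard_empty, Nat.cast_zero]
  | k + 1 => by
    classical
    ext i j
    rw [pow_succ, ← h.substMatrix_iter hQ hU k, Matrix.mul_apply]
    let t : Finset ((_ : Fin m) × ((A → A) × (A → A))) := Finset.univ.sigma fun l =>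
      (h.iter_finite k i l).toFinset ×ˢ (h.finite l j).toFinset
    have ht : Φ.iter (k + 1) i j = (t.image fun p => p.2.1 ∘ p.2.2 : Finset (A → A)) := by
      ext f
      simp only [t, MFS.iter, MFS.comp, Set.mem_ofPred_eq, Finset.coe_image, Set.mem_image,
        Finset.mem_coe, Finset.mem_sigma, Finset.mem_univ, true_and, Finset.mem_product,
        Set.Finite.mem_toFinset, Sigma.exists, Prod.exists]
      constructor
      · rintro ⟨l, g, hg, f, hf, rfl⟩
        exact ⟨l, g, f, ⟨hg, hf⟩, rfl⟩
      · rintro ⟨l, g, f, ⟨hg, hf⟩, rfl⟩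
        exact ⟨l, g, hg, f, hf, rfl⟩
    have hinj : Set.InjOn (fun p : (_ : Fin m) × ((A → A) × (A → A)) => p.2.1 ∘ p.2.2) t := by
      rintro ⟨l, g, f⟩ hp ⟨l', g', f'⟩ hp' heq
      simp only [t, Finset.coe_sigma, Set.mem_sigma_iff, Finset.mem_coe, Finset.mem_univ, true_and,
        Finset.mem_product, Set.Finite.mem_toFinset] at hp hp'
      simp only at heq
      -- A point of `U j` is what lets disjointness of images separate the compositions; empty
      -- images would be disjoint for trivial reasons.
      obtain ⟨x, hx⟩ := hU j
      have hlg : (l, g) = (l', g') := by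
        by_contra hne
        refine Set.disjoint_left.mp (h.iter_disjoint_images hQ k i l l' g hp.1 g' hp'.1 hne)
          (show g (f x) ∈ g '' U l from ⟨f x, h.image_subset hp.2 ⟨x, hx, rfl⟩, rfl⟩)
          ⟨f' x, h.image_subset hp'.2 ⟨x, hx, rfl⟩, (congrFun heq x).symm⟩
      obtain ⟨rfl, rfl⟩ := Prod.mk.inj hlg
      obtain ⟨a, ha⟩ := h.iter_affine k i l g hp.1
      have hg : Function.Injective g := fun x y hxy => by
        rw [ha, ha] at hxy
        exact pow_injective_of_injective hQ k (add_right_cancel hxy)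
      rw [hg.comp_left heq]
    change (((Φ.iter (k + 1) i j).ncard : ℕ) : ℝ) =
      ∑ l, (((Φ.iter k i l).ncard : ℕ) : ℝ) * (((Φ l j).ncard : ℕ) : ℝ)
    rw [ht, Set.ncard_coe_finset, Finset.card_image_of_injOn hinj, Finset.card_sigma, Nat.cast_sum]
    refine Finset.sum_congr rfl fun l _ => ?_
    rw [Finset.card_product, Nat.cast_mul, ← Set.ncard_eq_toFinset_card _ (h.iter_finite k i l),
      ← Set.ncard_eq_toFinset_card _ (h.finite l j)]

end IsSubstitutionSystem

end Iterates

/-! ### The equivalences -/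

theorem Matrix.pow_pos_of_forall_pos {m : ℕ} [Nonempty (Fin m)] {S : Matrix (Fin m) (Fin m) ℝ}
    (hS : ∀ i j, 0 < S i j) : ∀ (k : ℕ) (i j : Fin m), 0 < (S ^ (k + 1)) i j
  | 0, i, j => by simpa using hS i j
  | k + 1, i, j => by
    rw [pow_succ, Matrix.mul_apply]
    exact Finset.sum_pos (fun l _ => mul_pos (pow_pos_of_forall_pos hS k i l) (hS l j))
      Finset.univ_nonempty

theorem IsPFEigenvalue.pow {m : ℕ} {S : Matrix (Fin m) (Fin m) ℝ} {r : ℝ}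
    (h : IsPFEigenvalue S r) (N : ℕ) : IsPFEigenvalue (S ^ N) (r ^ N) := by
  obtain ⟨v, hv⟩ := h
  refine ⟨v, hv.pos, ?_⟩
  induction N with
  | zero => simp
  | succ N ih =>
    rw [pow_succ, ← Matrix.mulVec_mulVec, hv.eigen, Matrix.mulVec_smul, ih, smul_smul, pow_succ']

section Equivalences

variable {A : Type*} [AddCommGroup A] {m : ℕ} {Q : Module.End ℤ A} {U : Fin m → Set A}
  {Φ : MFS m A}

theorem exists_pow_apply_of_le {N M : ℕ} (h : M ≤ N) (x : A) : ∃ y, (Q ^ N) x = (Q ^ M) y :=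
  ⟨(Q ^ (N - M)) x, by rw [← Module.End.mul_apply, ← pow_add, Nat.add_sub_cancel' h]⟩

namespace IsSubstitutionSystem

theorem exists_coset_of_coincidence (h : IsSubstitutionSystem Q U Φ) (hΦ : Φ.AdmitsCoincidence)
    (hcover : ⋃ i, U i = Set.univ) : ∃ i, ∃ a : A, Set.range (fun x => a + Q x) ⊆ U i := by
  obtain ⟨i, g, hg⟩ := hΦ
  rw [Set.mem_iInter] at hg
  obtain ⟨j₀, -⟩ := Set.mem_iUnion.mp (hcover.symm ▸ Set.mem_univ (0 : A))
  obtain ⟨a, ha⟩ := h.affine i j₀ g (hg j₀)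
  refine ⟨i, a, ?_⟩
  rintro _ ⟨x, rfl⟩
  obtain ⟨j, hj⟩ := Set.mem_iUnion.mp (hcover.symm ▸ Set.mem_univ x)
  exact h.image_subset (hg j) ⟨x, hj, (ha x).trans (add_comm _ _)⟩

theorem exists_coset_iff_modularCoincidence [Module.Free ℤ A] [Module.Finite ℤ A]
    (h : IsSubstitutionSystem Q U Φ) (hprim : Φ.IsPrimitive) (hcover : ⋃ i, U i = Set.univ) :
    (∃ i, ∃ M : ℕ, ∃ a : A, Set.range (fun x => a + (Q ^ M) x) ⊆ U i) ↔
      AdmitsModularCoincidence Q Φ := by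
  constructor
  · rintro ⟨i, M, a, ha⟩
    -- The coset may have `M = 0`, whereas a modular coincidence needs a positive exponent.
    refine ⟨M + 1, M.succ_pos, a, i, ?_⟩
    rintro ⟨i', j, f⟩ ⟨hf, z, hz⟩
    obtain ⟨y, hy⟩ := h.nonempty hprim hcover j
    have hsys := h.iter M.succ_pos
    obtain ⟨b, hb⟩ := hsys.affine i' j f hf
    by_contra hne
    refine Set.disjoint_left.mp (h.disjoint hne) (hsys.image_subset hf ⟨y, hy, rfl⟩) ?_
    obtain ⟨w, hw⟩ := exists_pow_apply_of_le (Q := Q) M.le_succ (y + z)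
    refine ha ⟨w, ?_⟩
    simp only [hb, map_zero, zero_add] at hz ⊢
    rw [← hw, map_add, hz]
    abel
  · rintro ⟨M, hM, a, i, hi⟩
    refine ⟨i, M, a, ?_⟩
    rintro _ ⟨x, rfl⟩
    have hsys := h.iter hM
    obtain ⟨i', hi'⟩ := Set.mem_iUnion.mp (hcover.symm ▸ Set.mem_univ (a + (Q ^ M) x))
    obtain ⟨j, f, hf, y, hy, hfy⟩ := hsys.mem_iff.mp hi'
    obtain ⟨b, hb⟩ := hsys.affine i' j f hf
    obtain rfl : i' = i := hi (i', j, f) ⟨hf, x - y, by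
      rw [hb] at hfy
      simp only [hb, map_zero, zero_add, map_sub]
      rw [sub_eq_sub_iff_add_eq_add, add_comm _ a, ← hfy, add_comm]⟩
    exact hi'

theorem exists_coincidence_of_coset [Module.Free ℤ A] [Module.Finite ℤ A]
    (h : IsSubstitutionSystem Q U Φ) (hprim : Φ.IsPrimitive)
    (hPF : IsPFEigenvalue Φ.substMatrix ((|LinearMap.det Q| : ℤ) : ℝ))
    (hcover : ⋃ i, U i = Set.univ)
    (hcoset : ∃ i, ∃ M : ℕ, ∃ a : A, Set.range (fun x => a + (Q ^ M) x) ⊆ U i) :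
    ∃ M : ℕ, 1 ≤ M ∧ ∃ Ψ : MFS m A, Ψ.IsPrimitive ∧ Ψ.AdmitsCoincidence ∧
      EquivalentSystems (Q ^ M) U Ψ (Q ^ M) U (Φ.iter M) := by
  obtain ⟨i, M, a, ha⟩ := hcoset
  have : Nonempty (Fin m) := ⟨i⟩
  obtain ⟨k, hk, hkpos⟩ := hprim.exists_pos_pow
  -- A multiple of `k` keeps the matrix power positive, and being at least `M` it shrinks the coset
  -- to one of the inflation in use.
  have hN : 0 < k * (M + 1) := Nat.mul_pos hk M.succ_pos
  have hMN : M ≤ k * (M + 1) := M.le_succ.trans (Nat.le_mul_of_pos_left _ hk)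
  have hS := h.substMatrix_iter h.inflation.injective (h.nonempty hprim hcover) (k * (M + 1))
  refine ⟨_, hN, (h.iter hN).exists_equivalent_coincidence hcover ?_ ?_ (i := i) (a := a) ?_⟩
  · rw [hS, pow_mul]
    exact Matrix.pow_pos_of_forall_pos hkpos M
  · rw [hS, map_pow, Int.natAbs_pow, Nat.cast_pow, Nat.cast_natAbs]
    exact hPF.pow _
  · intro x
    obtain ⟨y, hy⟩ := exists_pow_apply_of_le (Q := Q) hMN x
    exact ha ⟨y, by rw [hy]⟩

/-- A map of `Φ ^ k` from column `j` to row `i` sends `a + Q ^ M A` onto `f a + Q ^ (k + M) A`. -/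
theorem exists_coset_forall [Module.Free ℤ A] [Module.Finite ℤ A]
    (h : IsSubstitutionSystem Q U Φ) (hprim : Φ.IsPrimitive)
    (hcoset : ∃ i, ∃ M : ℕ, ∃ a : A, Set.range (fun x => a + (Q ^ M) x) ⊆ U i) (i : Fin m) :
    ∃ M : ℕ, ∃ a : A, Set.range (fun x => a + (Q ^ M) x) ⊆ U i := by
  obtain ⟨j, M, a, ha⟩ := hcoset
  obtain ⟨k, hk, hkpos⟩ := hprim.exists_pos_pow
  obtain ⟨f, hf⟩ := Φ.iter_nonempty_of_pos k i j (hkpos i j)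
  have hsys := h.iter hk
  obtain ⟨b, hb⟩ := hsys.affine i j f hf
  refine ⟨k + M, f a, ?_⟩
  rintro _ ⟨x, rfl⟩
  refine hsys.image_subset hf ⟨_, ha ⟨x, rfl⟩, ?_⟩
  simp only [hb, map_add, pow_add, Module.End.mul_apply]
  rw [add_right_comm]

end IsSubstitutionSystem

/-! ### Cosets and open sets of the completion -/

theorem QLevel.mk_eq_mk_iff {k : ℕ} {x y : A} :
    QLevel.mk Q k x = QLevel.mk Q k y ↔ ∃ z, x = y + (Q ^ k) z :=
  mkQ_eq_mkQ_iff

theorem QCompletion.of_injective (hQ : IsInflation Q) : Function.Injective (QCompletion.of Q) := by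
  refine (injective_iff_map_eq_zero _).mpr fun x hx => ?_
  rw [← Submodule.mem_bot ℤ, ← hQ.iInf_range, Submodule.mem_iInf]
  exact fun k => (Submodule.Quotient.mk_eq_zero _).mp (congrFun (congrArg Subtype.val hx) k)

theorem QCompletion.isOpen_level (Q : Module.End ℤ A) (k : ℕ) (w : QLevel Q k) :
    IsOpen {x : QCompletion Q | x.1 k = w} :=
  (isOpen_discrete {w}).preimage ((continuous_apply k).comp continuous_subtype_val)

/-- A non-empty open subset of the completion contains the closure of a coset of some
`Q ^ k A`. -/
theorem QCompletion.exists_coset_of_isOpen {O : Set (QCompletion Q)} (hO : IsOpen O)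
    (hne : O.Nonempty) : ∃ (k : ℕ) (a : A), ∀ x : A, QCompletion.of Q (a + (Q ^ k) x) ∈ O := by
  obtain ⟨_, ha, a, rfl⟩ := (QCompletion.denseRange_of Q).inter_open_nonempty O hO hne
  obtain ⟨O', hO', rfl⟩ := isOpen_induced_iff.mp hO
  obtain ⟨I, u, hu, hIu⟩ := isOpen_pi_iff.mp hO' _ ha
  refine ⟨I.sup id, a, fun x => hIu fun k hk => ?_⟩
  have hlevel : (QCompletion.of Q (a + (Q ^ I.sup id) x)).1 (I.sup id) =
      (QCompletion.of Q a).1 (I.sup id) := QLevel.mk_eq_mk_iff.mpr ⟨x, rfl⟩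
  rw [QCompletion.ext_level hlevel k (Finset.le_sup (f := id) hk)]
  exact (hu k hk).2

end Equivalences

/-! ### Model sets of the `Q`-adic scheme -/

section ModelSets

variable {n : ℕ} {L : Submodule ℤ (EuclideanSpace ℝ (Fin n))} [DiscreteTopology L]
  [IsZLattice ℝ L] {Q : Module.End ℤ L}

theorem mem_qAdicScheme_cut (hQ : IsInflation Q) {V : Set (QCompletion Q)}
    {x : EuclideanSpace ℝ (Fin n)} :
    x ∈ (qAdicScheme L hQ).cut V ↔ ∃ t : L, (t : EuclideanSpace ℝ (Fin n)) = x ∧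
      QCompletion.of Q t ∈ V := by
  constructor
  · rintro ⟨_, ⟨t, rfl⟩, hx, hV⟩
    exact ⟨t, hx, hV⟩
  · rintro ⟨t, hx, hV⟩
    exact ⟨_, ⟨t, rfl⟩, hx, hV⟩

theorem exists_coset_of_isModelSet (hQ : IsInflation Q) {Y : Set L}
    (hY : (qAdicScheme L hQ).IsModelSet (Subtype.val '' Y)) :
    ∃ M : ℕ, ∃ a : L, Set.range (fun x => a + (Q ^ M) x) ⊆ Y := by
  obtain ⟨V, hV, -, t, ht⟩ := hY
  obtain ⟨k, a, ha⟩ := QCompletion.exists_coset_of_isOpen isOpen_interior hV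
  have hmem : ∀ x, ∃ y ∈ Y, (y : EuclideanSpace ℝ (Fin n)) = t + (a + (Q ^ k) x : L) := by
    intro x
    have : t + ((a + (Q ^ k) x : L) : EuclideanSpace ℝ (Fin n)) ∈ Subtype.val '' Y := by
      rw [ht]
      exact ⟨_, (mem_qAdicScheme_cut hQ).mpr ⟨_, rfl, interior_subset (ha x)⟩, rfl⟩
    exact this
  -- The translation `t` is not assumed to lie in `L`, but `t + a` does; it becomes the base point
  -- of the coset.
  obtain ⟨y₀, -, hy₀⟩ := hmem 0
  refine ⟨k, y₀, ?_⟩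
  rintro _ ⟨x, rfl⟩
  obtain ⟨y, hyY, hy⟩ := hmem x
  convert hyY
  apply Subtype.ext
  simp only [map_zero, add_zero] at hy₀
  rw [hy, Submodule.coe_add, hy₀, Submodule.coe_add, add_assoc]

theorem isModelSet_of_coset (hQ : IsInflation Q) {Y : Set L} {M : ℕ} {a : L}
    (ha : Set.range (fun x => a + (Q ^ M) x) ⊆ Y) :
    (qAdicScheme L hQ).IsModelSet (Subtype.val '' Y) := by
  have : Module.Finite ℤ L := ZLattice.module_finite ℝ L
  have : Module.Free ℤ L := ZLattice.module_free ℝ L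
  have := hQ.compactSpace
  -- The image of `Y` itself may have empty interior. The complement of the image of `Yᶜ` has the
  -- same trace on `L` and contains the whole open level set around `a`.
  refine ⟨(QCompletion.of Q '' Yᶜ)ᶜ, ⟨QCompletion.of Q a, ?_⟩, isClosed_closure.isCompact, 0, ?_⟩
  · refine mem_interior.mpr ⟨_, ?_, QCompletion.isOpen_level Q M (QLevel.mk Q M a), rfl⟩
    rintro _ hx ⟨y, hy, rfl⟩
    obtain ⟨z, hz⟩ := QLevel.mk_eq_mk_iff.mp hx
    exact hy (ha ⟨z, hz.symm⟩)
  · ext x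
    simp only [zero_add, Set.image_id', mem_qAdicScheme_cut, Set.mem_compl_iff,
      (QCompletion.of_injective hQ).mem_set_image, not_not]
    exact exists_congr fun t => and_comm

end ModelSets

theorem mainTheorem1 {n m : ℕ} (L : Submodule ℤ (EuclideanSpace ℝ (Fin n)))
    [DiscreteTopology L] [IsZLattice ℝ L]
    (Q : Module.End ℤ L) (U : Fin m → Set L) (Φ : MFS m L)
    (hsys : IsSubstitutionSystem Q U Φ)
    (hprim : Φ.IsPrimitive)
    (hPF : IsPFEigenvalue Φ.substMatrix ((|LinearMap.det Q| : ℤ) : ℝ))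
    (hcover : ⋃ i, U i = Set.univ) :
    List.TFAE [
      ∃ M : ℕ, 1 ≤ M ∧ ∃ Ψ : MFS m L, Ψ.IsPrimitive ∧ Ψ.AdmitsCoincidence ∧
        EquivalentSystems (Q ^ M) U Ψ (Q ^ M) U (Φ.iter M),
      ∀ i, (qAdicScheme L hsys.inflation).IsModelSet (Subtype.val '' U i),
      ∃ i, ∃ M : ℕ, ∃ a : L, (Set.range fun x : L => a + (Q ^ M) x) ⊆ U i,
      AdmitsModularCoincidence Q Φ] := by
  have : Module.Finite ℤ L := ZLattice.module_finite ℝ L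
  have : Module.Free ℤ L := ZLattice.module_free ℝ L
  tfae_have 1 → 3 := by
    rintro ⟨M, -, Ψ, -, hΨ, hsysΨ, -⟩
    obtain ⟨i, a, ha⟩ := hsysΨ.exists_coset_of_coincidence hΨ hcover
    exact ⟨i, M, a, ha⟩
  tfae_have 3 → 1 := hsys.exists_coincidence_of_coset hprim hPF hcover
  tfae_have 3 → 2 := fun h i => by
    obtain ⟨M, a, ha⟩ := hsys.exists_coset_forall hprim h i
    exact isModelSet_of_coset _ ha
  tfae_have 2 → 3 := fun h => by
    -- Covering the point `0` supplies an index, without which (ii) would be vacuous.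
    obtain ⟨i, -⟩ := Set.mem_iUnion.mp (hcover.symm ▸ Set.mem_univ (0 : L))
    exact ⟨i, exists_coset_of_isModelSet _ (h i)⟩
  tfae_have 3 ↔ 4 := hsys.exists_coset_iff_modularCoincidence hprim hcover
  tfae_finish
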